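/- Let $k$ be a commutative Noetherian ring and let $m \ge 1$ be an integer. Let $\mathrm{FI}$ be the category whose objects are the finite sets $[n]=\{1,\dots,n\}$, $n \ge 0$, and whose morphisms are the injections, and let $\mathrm{FI}^m$ be its $m$-fold product. An $\mathrm{FI}^m$-module over $k$ is a functor $V$ from $\mathrm{FI}^m$ to the category of $k$-modules; we write $V_{\mathbf n}$ for its value at $([n_1],\dots,[n_m])$. It is finitely generated if there are finitely many elements of $\bigsqcup_{\mathbf n} V_{\mathbf n}$ that are not all contained in any proper submodule of $V$. An element $v \in V_{\mathbf n}$ is $B$-torsion if it is in the kernel of the map $V_{\mathbf n} \to V_{\mathbf r}$ induced by some morphism $(f_1,\dots,f_m)\colon \mathbf n \to \mathbf r$ of $\mathrm{FI}^m$ with at least one $f_j$ not invertible, and $V$ is $B$-torsion if all of its elements are. The $B$-torsion elements of $V$ form a submodule $V_T$; let $H^i_B$ denote the $i$-th right derived functor of the left exact functor $V \mapsto V_T$ on the category of $\mathrm{FI}^m$-modules over $k$. If $V$ is a finitely generated $B$-torsion $\mathrm{FI}^m$-module over $k$, then $H^i_B(V) = 0$ for all $i \geq 1$. -/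

import Mathlib

open CategoryTheory CategoryTheory.Limits

universe u

/-- The objects `[n] = {1, …, n}` of the category `FI`, indexed by natural numbers. -/
structure FI : Type where
  /-- the number of elements -/
  card : ℕ

/-- Morphisms `[a] ⟶ [b]` in `FI` are the injections from an `a`-element to a `b`-element set. -/
instance FI.category : Category.{0} FI where
  Hom a b := Fin a.card ↪ Fin b.card
  id a := Function.Embedding.refl (Fin a.card)
  comp f g := Function.Embedding.trans f g

/-- The `m`-fold product category `FI^m`: objects are vectors `n = (n₁, …, n_m)` and morphisms are
`m`-tuples of injections. -/
abbrev FIPow (m : ℕ) : Type := Fin m → FI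

/-- The category of `FI^m`-modules over `k`: functors from `FI^m` to `k`-modules. -/
abbrev FIModule (k : Type u) [CommRing k] (m : ℕ) : Type (u + 1) :=
  FIPow m ⥤ ModuleCat.{u} k

namespace FIModule

/-- A morphism of `FI^m` induces transition maps when at least one of its components is not
invertible. -/
def IsTransition {m : ℕ} {a b : FIPow m} (f : a ⟶ b) : Prop :=
  ∃ j : Fin m, ¬ IsIso (f j)

variable {k : Type u} [CommRing k] {m : ℕ}

/-- An element `v ∈ V_a` is `B`-torsion if some transition map out of `V_a` kills it. -/
def IsTorsionElement (V : FIModule k m) {a : FIPow m} (v : V.obj a) : Prop :=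
  ∃ (b : FIPow m) (f : a ⟶ b), IsTransition f ∧ (V.map f).hom v = 0

/-- `V` is `B`-torsion if all of its elements are. -/
def IsTorsion (V : FIModule k m) : Prop :=
  ∀ (a : FIPow m) (v : V.obj a), IsTorsionElement V v

/-- `V` is finitely generated: there are finitely many elements of the disjoint union of the `V_a` such that every
submodule (a family of `k`-submodules of the `V_a` stable under all morphisms of `FI^m`) that
contains them is all of `V`. -/
def IsFinitelyGenerated (V : FIModule k m) : Prop :=
  ∃ S : Set (Σ a : FIPow m, V.obj a), S.Finite ∧
    ∀ W : (a : FIPow m) → Submodule k (V.obj a),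
      (∀ (a b : FIPow m) (f : a ⟶ b), ∀ v ∈ W a, (V.map f).hom v ∈ W b) →
      (∀ s ∈ S, s.2 ∈ W s.1) →
      ∀ a : FIPow m, W a = ⊤

/-! ### The `B`-torsion functor -/

/-- The standard inclusion `[a] ⟶ [b]` for `a ≤ b` componentwise. -/
def incl {a b : FIPow m} (h : ∀ j, (a j).card ≤ (b j).card) : a ⟶ b :=
  fun j => (Fin.castLEEmb (h j) : Fin (a j).card ↪ Fin (b j).card)

lemma card_le {a b : FIPow m} (f : a ⟶ b) (j : Fin m) : (a j).card ≤ (b j).card := by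
  simpa using Fintype.card_le_of_embedding (f j : Fin (a j).card ↪ Fin (b j).card)

lemma isTransition_of_lt {a b : FIPow m} (f : a ⟶ b) (j : Fin m)
    (h : (a j).card < (b j).card) : IsTransition f := by
  refine ⟨j, fun hf => ?_⟩
  have := Fintype.card_le_of_embedding (inv (f j) : Fin (b j).card ↪ Fin (a j).card)
  simp only [Fintype.card_fin] at this
  omega

lemma exists_comp_eq {a b : FIPow m} (f g : a ⟶ b) : ∃ σ : b ⟶ b, f ≫ σ = g := by
  have h : ∀ (c d : FI) (p q : Fin c.card ↪ Fin d.card), ∃ σ : Fin d.card ↪ Fin d.card,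
      p.trans σ = q := fun c d p q => by
    obtain ⟨σ, hσ⟩ := Equiv.Perm.exists_extending_pair p q p.injective q.injective
    exact ⟨σ.toEmbedding, Function.Embedding.ext hσ⟩
  choose σ hσ using fun j => h (a j) (b j) (f j) (g j)
  exact ⟨σ, funext hσ⟩

lemma map_eq_zero_of_le (V : FIModule k m) {a b c : FIPow m} {v : V.obj a} (f : a ⟶ b)
    (hf : (V.map f).hom v = 0) (h : ∀ j, (b j).card ≤ (c j).card) (g : a ⟶ c) :
    (V.map g).hom v = 0 := by
  obtain ⟨σ, rfl⟩ := exists_comp_eq (f ≫ incl h) g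
  simp [hf]

/-- The `B`-torsion elements of `V_a` form a `k`-submodule. -/
def torsionSubmodule [NeZero m] (V : FIModule k m) (a : FIPow m) : Submodule k (V.obj a) where
  carrier := {v | IsTorsionElement V v}
  zero_mem' := by
    refine ⟨fun j => ⟨(a j).card + 1⟩, incl fun j => Nat.le_succ _, ?_, map_zero _⟩
    exact isTransition_of_lt _ 0 (Nat.lt_succ_self _)
  add_mem' := by
    rintro v w ⟨b, f, -, hf⟩ ⟨c, g, -, hg⟩
    have hb := card_le f
    refine ⟨fun j => ⟨(b j).card + (c j).card + 1⟩,
      incl fun j => show _ ≤ (b j).card + (c j).card + 1 by have := hb j; omega, ?_, ?_⟩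
    · refine isTransition_of_lt _ 0 ?_
      have := hb 0
      show _ < (b 0).card + (c 0).card + 1
      omega
    · rw [map_add, map_eq_zero_of_le V f hf (fun j => ?_), map_eq_zero_of_le V g hg (fun j => ?_),
        add_zero]
      · show _ ≤ (b j).card + (c j).card + 1
        omega
      · show _ ≤ (b j).card + (c j).card + 1
        omega
  smul_mem' := by
    rintro r v ⟨b, f, ht, hf⟩
    exact ⟨b, f, ht, by rw [map_smul, hf, smul_zero]⟩

lemma map_mem_torsionSubmodule [NeZero m] (V : FIModule k m) {a b : FIPow m} (h : a ⟶ b)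
    (v : V.obj a) (hv : v ∈ torsionSubmodule V a) :
    (V.map h).hom v ∈ torsionSubmodule V b := by
  obtain ⟨c, f, -, hf⟩ := hv
  let d : FIPow m := fun j => ⟨(b j).card + (c j).card + 1⟩
  have hbd : ∀ j, (b j).card ≤ (d j).card := fun j => by simp only [d]; omega
  have hcd : ∀ j, (c j).card ≤ (d j).card := fun j => by simp only [d]; omega
  refine ⟨d, incl hbd, isTransition_of_lt _ 0 (by simp only [d]; omega), ?_⟩
  simpa using map_eq_zero_of_le V f hf hcd (h ≫ incl hbd)

lemma app_mem_torsionSubmodule [NeZero m] {V W : FIModule k m} (φ : V ⟶ W) {a : FIPow m}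
    (v : V.obj a) (hv : v ∈ torsionSubmodule V a) :
    (φ.app a).hom v ∈ torsionSubmodule W a := by
  obtain ⟨c, f, ht, hf⟩ := hv
  refine ⟨c, f, ht, ?_⟩
  have h := congrArg (fun g => g.hom v) (φ.naturality f)
  simp only [ModuleCat.hom_comp, LinearMap.comp_apply] at h
  rw [← h, hf, map_zero]

/-- The maximal `B`-torsion submodule `V_T` of `V`, as an `FI^m`-module. -/
def torsionPart [NeZero m] (V : FIModule k m) : FIModule k m where
  obj a := ModuleCat.of k (torsionSubmodule V a)
  map f := ModuleCat.ofHom ((V.map f).hom.restrict (map_mem_torsionSubmodule V f))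
  map_id a := by
    ext v
    exact congrArg (fun g => g.hom v.1) (V.map_id a)
  map_comp f g := by
    ext v
    exact congrArg (fun h => h.hom v.1) (V.map_comp f g)

variable (k m)

/-- The `B`-torsion functor `V ↦ V_T`. -/
def torsionFunctor [NeZero m] : FIModule k m ⥤ FIModule k m where
  obj V := torsionPart V
  map φ :=
    { app := fun a =>
        ModuleCat.ofHom ((φ.app a).hom.restrict (app_mem_torsionSubmodule φ))
      naturality := fun a b f => by
        ext v
        exact Subtype.ext (congrArg (fun g => g.hom v.1) (φ.naturality f)) }
  map_id V := by ext a v; exact Subtype.ext rfl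
  map_comp φ ψ := by ext a v; exact Subtype.ext rfl

instance torsionFunctor_additive [NeZero m] : (torsionFunctor k m).Additive where
  map_add {V W φ ψ} := by ext a v; exact Subtype.ext rfl

/-! ### Local cohomology -/

instance hasSeparator : HasSeparator (FIModule k m) :=
  HasSeparator.of_equivalence ((opOpEquivalence (FIPow m)).congrLeft (E := ModuleCat.{u} k))

instance ab5 : AB5OfSize.{u, u} (FIModule k m) where
  ofShape K _ _ := by infer_instance

/-- `FI^m`-modules form a Grothendieck abelian category; in particular there are enough
injectives. -/
instance isGrothendieckAbelian : IsGrothendieckAbelian.{u} (FIModule k m) where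

/-- The local cohomology functor `H^i_B`: the `i`-th right derived functor of the `B`-torsion
functor. -/
noncomputable def localCohomology [NeZero m] (i : ℕ) : FIModule k m ⥤ FIModule k m :=
  (torsionFunctor k m).rightDerived i

end FIModule

/-! Each of the finitely many generators of a finitely generated torsion module `V` dies in some
degree, so there is a `b` such that `V` vanishes at every object receiving a morphism from `b`. The
objects receiving no morphism from `b` are closed under sources of morphisms; hence right Kan
extension from the full subcategory they span is extension by zero, which is exact and preserves
injectives. Extending an injective resolution of the restriction of `V` therefore gives an injective
resolution of `V` whose terms all vanish at the objects receiving a morphism from `b`. Such modules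
are torsion, so the torsion functor leaves this resolution unchanged, and its cohomology is zero in
positive degrees. -/

universe v w v' w'

section DerivedFunctors

variable {A B : Type*} [Category* A] [Abelian A] [Category* B] [Abelian B]

/-- The injective resolution of `F.obj X` obtained by applying termwise to an injective resolution
of `X` an exact functor `F` that preserves injective objects. -/
noncomputable def mapInjectiveResolution (F : A ⥤ B) [F.Additive] [F.PreservesHomology]
    [F.PreservesInjectiveObjects] {X : A} (I : InjectiveResolution X) :
    InjectiveResolution (F.obj X) where
  cocomplex := (F.mapHomologicalComplex _).obj I.cocomplex
  injective n := F.injective_obj (I.cocomplex.X n)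
  ι := (HomologicalComplex.singleMapHomologicalComplex F (ComplexShape.up ℕ) 0).inv.app X ≫
    (F.mapHomologicalComplex _).map I.ι

theorem isZero_rightDerived_succ_obj_of_isIso_app [HasInjectiveResolutions A] {F E : A ⥤ B}
    [F.Additive] [E.Additive] [E.PreservesHomology] (α : F ⟶ E) {X : A}
    (I : InjectiveResolution X) (hα : ∀ n, IsIso (α.app (I.cocomplex.X n))) (n : ℕ) :
    IsZero ((F.rightDerived (n + 1)).obj X) := by
  let φ := (NatTrans.mapHomologicalComplex α (ComplexShape.up ℕ)).app I.cocomplex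
  have : ∀ i, IsIso (φ.f i) := hα
  have : IsIso φ := HomologicalComplex.Hom.isIso_of_components φ
  have hE : ((E.mapHomologicalComplex (ComplexShape.up ℕ)).obj I.cocomplex).ExactAt (n + 1) :=
    ShortComplex.Exact.map (I.cocomplex_exactAt_succ n) E
  exact hE.isZero_homology.of_iso (I.isoRightDerivedObj F (n + 1) ≪≫
    (HomologicalComplex.homologyFunctor B (ComplexShape.up ℕ) (n + 1)).mapIso (asIso φ))

end DerivedFunctors

theorem isGrothendieckAbelian_functorCategory (J : Type w) [Category.{w} J] (H : Type*)
    [Category.{max w u} H] [Abelian H] [IsGrothendieckAbelian.{max w u} H] :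
    IsGrothendieckAbelian.{max w u} (J ⥤ H) where
  ab5OfSize := ⟨fun _ _ _ => inferInstance⟩
  hasSeparator := by
    have : HasColimitsOfSize.{w, w} H := hasColimitsOfSizeShrink.{w, w, max w u, max w u} H
    exact HasSeparator.of_equivalence ((opOpEquivalence J).congrLeft (E := H))

section ExtensionByZero

variable {J : Type w} [Category.{v} J] {H : Type w'} [Category.{v'} H]

/-- The functors that vanish at every object outside of `P`. When `P` is closed under sources of
morphisms, these are the extensions by zero of functors on the full subcategory `P`. -/
def supportedOn (P : ObjectProperty J) : ObjectProperty (J ⥤ H) :=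
  fun V => ∀ a, ¬ P a → IsZero (V.obj a)

variable (P : ObjectProperty J) [P.InheritedFromTarget ⊤]

lemma isEmpty_structuredArrow_ι {a : J} (ha : ¬ P a) : IsEmpty (StructuredArrow a P.ι) :=
  ⟨fun f => ha (P.of_hom_of_target (Q := ⊤) f.hom trivial f.right.property)⟩

variable [HasLimitsOfSize.{v, max w v} H]

section HasZeroMorphisms

variable [HasZeroMorphisms H]

lemma supportedOn_ran_obj (W : P.FullSubcategory ⥤ H) : supportedOn P (P.ι.ran.obj W) := by
  intro a ha
  have := isEmpty_structuredArrow_ι P ha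
  refine IsZero.of_iso ?_ (P.ι.ranObjObjIsoLimit W a)
  exact (IsZero.iff_id_eq_zero _).2 (limit.hom_ext isEmptyElim)

lemma isIso_ranAdjunction_unit_app_of_supportedOn {V : J ⥤ H} (hV : supportedOn P V) :
    IsIso ((P.ι.ranAdjunction H).unit.app V) := by
  rw [NatTrans.isIso_iff_isIso_app]
  intro a
  by_cases ha : P a
  · have h := P.ι.ranCounit_app_app_ranAdjunction_unit_app_app V ⟨a, ha⟩
    exact isIso_of_comp_hom_eq_id _ h
  · exact IsZero.isIso (hV a ha) (supportedOn_ran_obj P (P.ι ⋙ V) a ha) _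

end HasZeroMorphisms

variable [Abelian H]

instance preservesEpimorphisms_ran : (P.ι.ran (H := H)).PreservesEpimorphisms where
  preserves {W W'} φ hφ := by
    refine (NatTrans.epi_iff_epi_app _).2 fun a => ?_
    by_cases ha : P a
    · have h : (P.ι.ran.map φ).app a ≫ (P.ι.ranCounit.app W').app ⟨a, ha⟩ =
          (P.ι.ranCounit.app W).app ⟨a, ha⟩ ≫ φ.app ⟨a, ha⟩ :=
        congr_app (P.ι.ranCounit.naturality φ) ⟨a, ha⟩
      have := epi_comp ((P.ι.ranCounit.app W).app ⟨a, ha⟩) (φ.app ⟨a, ha⟩)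
      rw [(IsIso.eq_comp_inv _).2 h]
      infer_instance
    · exact IsZero.epi (supportedOn_ran_obj P W' a ha) _

instance additive_ran : (P.ι.ran (H := H)).Additive :=
  (P.ι.ranAdjunction H).right_adjoint_additive

instance preservesHomology_ran : (P.ι.ran (H := H)).PreservesHomology :=
  have := (P.ι.ranAdjunction H).isRightAdjoint
  Functor.preservesHomology_of_preservesEpis_and_kernels _

theorem exists_injectiveResolution_supportedOn [HasInjectiveResolutions (P.FullSubcategory ⥤ H)]
    {V : J ⥤ H} (hV : supportedOn P V) :
    ∃ I : InjectiveResolution V, ∀ n, supportedOn P (I.cocomplex.X n) := by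
  let adj := P.ι.ranAdjunction H
  have := Functor.preservesInjectiveObjects_of_adjunction_of_preservesMonomorphisms adj
  have := isIso_ranAdjunction_unit_app_of_supportedOn P hV
  obtain ⟨I⟩ := HasInjectiveResolution.out (Z := P.ι ⋙ V)
  let I' := mapInjectiveResolution P.ι.ran I
  exact ⟨{ cocomplex := I'.cocomplex
           ι := (CochainComplex.single₀ (J ⥤ H)).map (adj.unit.app V) ≫ I'.ι },
    fun n => supportedOn_ran_obj P (I.cocomplex.X n)⟩

end ExtensionByZero

/-- The objects that receive no morphism from `b`. In `FI^m` these are the vectors that do not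
dominate `b` componentwise. -/
def noHomFrom {J : Type*} [Category* J] (b : J) : ObjectProperty J :=
  fun a => IsEmpty (b ⟶ a)

instance noHomFrom.inheritedFromTarget {J : Type*} [Category* J] (b : J) :
    (noHomFrom b).InheritedFromTarget ⊤ where
  of_hom_of_target f _ h := ⟨fun g => h.false (g ≫ f)⟩

namespace FIModule

lemma exists_forall_mem_nonempty_hom {m : ℕ} {ι : Type*} {S : Set ι} (hS : S.Finite)
    (c : ι → FIPow m) : ∃ b, ∀ s ∈ S, Nonempty (c s ⟶ b) :=
  ⟨fun j => ⟨∑ s ∈ hS.toFinset, (c s j).card⟩, fun _ hs => ⟨incl fun j =>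
    Finset.single_le_sum (f := fun s => (c s j).card) (fun _ _ => Nat.zero_le _)
      (hS.mem_toFinset.2 hs)⟩⟩

variable {k : Type u} [CommRing k] {m : ℕ}

theorem IsFinitelyGenerated.exists_supportedOn_noHomFrom {V : FIModule k m}
    (hfg : IsFinitelyGenerated V) (htors : IsTorsion V) :
    ∃ b : FIPow m, supportedOn (noHomFrom b) V := by
  obtain ⟨S, hS, hgen⟩ := hfg
  choose c f _ hf using fun s : Σ a, V.obj a => htors s.1 s.2
  obtain ⟨b, hb⟩ := exists_forall_mem_nonempty_hom hS c
  let W (a : FIPow m) : Submodule k (V.obj a) :=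
    ⨅ (d : FIPow m) (_ : b ⟶ d) (g : a ⟶ d), LinearMap.ker (V.map g).hom
  have mem_W {a : FIPow m} {v : V.obj a} :
      v ∈ W a ↔ ∀ d, (b ⟶ d) → ∀ g : a ⟶ d, (V.map g).hom v = 0 := by
    simp only [W, Submodule.mem_iInf, LinearMap.mem_ker]
  have W_eq_top : ∀ a, W a = ⊤ := by
    refine hgen W (fun a a' g v hv => mem_W.2 fun d h g' => ?_)
      (fun s hs => mem_W.2 fun d h g => ?_)
    · simpa using mem_W.1 hv d h (g ≫ g')
    · obtain ⟨h'⟩ := hb s hs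
      exact map_eq_zero_of_le V (f s) (hf s) (card_le (h' ≫ h)) g
  refine ⟨b, fun a ha => ?_⟩
  obtain ⟨h⟩ := not_isEmpty_iff.1 ha
  refine ModuleCat.isZero_of_iff_subsingleton.2 (subsingleton_of_forall_eq 0 fun v => ?_)
  have hv : v ∈ W a := W_eq_top a ▸ Submodule.mem_top
  simpa using mem_W.1 hv a h (𝟙 a)

variable [NeZero m]

lemma isTorsion_of_supportedOn_noHomFrom {V : FIModule k m} {b : FIPow m}
    (hV : supportedOn (noHomFrom b) V) : IsTorsion V := by
  intro a v
  let d : FIPow m := fun j => ⟨(a j).card + (b j).card + 1⟩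
  have had (j : Fin m) : (a j).card < (d j).card := by simp only [d]; omega
  have hbd (j : Fin m) : (b j).card ≤ (d j).card := by simp only [d]; omega
  have : Subsingleton (V.obj d) :=
    ModuleCat.subsingleton_of_isZero (hV d (not_isEmpty_iff.2 ⟨incl hbd⟩))
  exact ⟨d, incl fun j => (had j).le, isTransition_of_lt _ 0 (had 0), Subsingleton.elim _ _⟩

variable (k m) in
/-- The inclusion of the maximal `B`-torsion submodule, natural in the module. -/
def torsionι : torsionFunctor k m ⟶ 𝟭 (FIModule k m) where
  app V := { app := fun a => ModuleCat.ofHom (torsionSubmodule V a).subtype }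

lemma IsTorsion.isIso_torsionι_app {V : FIModule k m} (hV : IsTorsion V) :
    IsIso ((torsionι k m).app V) := by
  refine (NatTrans.isIso_iff_isIso_app _).2 fun a => (ConcreteCategory.isIso_iff_bijective _).2 ?_
  exact ⟨Subtype.val_injective, fun v => ⟨⟨v, hV a v⟩, rfl⟩⟩

theorem isZero_localCohomology_succ_obj_of_supportedOn_noHomFrom {V : FIModule k m}
    {b : FIPow m} (hV : supportedOn (noHomFrom b) V) (n : ℕ) :
    IsZero ((localCohomology k m (n + 1)).obj V) := by
  have := isGrothendieckAbelian_functorCategory.{u} (noHomFrom b).FullSubcategory (ModuleCat.{u} k)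
  obtain ⟨I, hI⟩ := exists_injectiveResolution_supportedOn (noHomFrom b) hV
  exact isZero_rightDerived_succ_obj_of_isIso_app (torsionι k m) I
    (fun i => (isTorsion_of_supportedOn_noHomFrom (hI i)).isIso_torsionι_app) n

end FIModule

theorem mainTheorem8_general (k : Type u) [CommRing k] (m : ℕ) [NeZero m]
    (V : FIModule k m) (hfg : FIModule.IsFinitelyGenerated V) (htors : FIModule.IsTorsion V)
    (i : ℕ) (hi : 1 ≤ i) :
    IsZero ((FIModule.localCohomology k m i).obj V) := by
  obtain ⟨b, hb⟩ := hfg.exists_supportedOn_noHomFrom htors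
  obtain ⟨n, rfl⟩ := Nat.exists_eq_add_of_le' hi
  exact FIModule.isZero_localCohomology_succ_obj_of_supportedOn_noHomFrom hb n

theorem mainTheorem8 (k : Type u) [CommRing k] [IsNoetherianRing k] (m : ℕ) [NeZero m]
    (V : FIModule k m) (hfg : FIModule.IsFinitelyGenerated V) (htors : FIModule.IsTorsion V)
    (i : ℕ) (hi : 1 ≤ i) :
    IsZero ((FIModule.localCohomology k m i).obj V) :=
  mainTheorem8_general k m V hfg htors i hi
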